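/- Let $D$ be the open unit disk, $dA$ the area measure on $D$ normalized by $A(D)=1$, and for $\alpha>-1$ let $dA_\alpha(z)=(\alpha+1)(1-|z|^2)^\alpha\,dA(z)$. For $p>0$ the weighted Dirichlet space $D^p_\alpha$ consists of the analytic functions $f$ on $D$ with $$\|f\|_{D^p_\alpha}=|f(0)|+\Big(\int_D|f'(z)|^p\,dA_\alpha(z)\Big)^{1/p}<\infty .$$ For an arc $I$ of the unit circle $\partial D$ of normalized length $|I|\in(0,1]$ (so $|\partial D|=1$) let $S(I)=\{z:1-|I|<|z|<1,\ z/|z|\in I\}$ if $|I|<1$, and let $S(\partial D)=D$ (origin included). For a nonnegative Borel measure $\mu$ on $D$ put $$\|\mu\|_{LCM_{p,s}}=\sup_{I\subset\partial D}\frac1{|I|^s}\Big(\log\frac2{|I|}\Big)^p\mu(S(I)).$$ The measure $\mu$ is a $(p,s)$-logarithmic Carleson measure, $\mu\in LCM_{p,s}$, if $\|\mu\|_{LCM_{p,s}}<\infty$, and a vanishing $(p,s)$-logarithmic Carleson measure if $\frac1{|I|^s}\big(\log\frac2{|I|}\big)^p\mu(S(I))\to0$ as $|I|\to0$, uniformly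 over the arcs of length $|I|$. It is a Carleson measure for $D^p_\alpha$ if there is a constant $C'>0$ with $\int_D|f|^p\,d\mu\le C'\|f\|_{D^p_\alpha}^p$ for all $f\in D^p_\alpha$, and a compact Carleson measure for $D^p_\alpha$ if $\|f_n\|_{L^p(\mu)}\to0$ for every bounded sequence $(f_n)$ in $D^p_\alpha$ that converges to $0$ uniformly on compact subsets of $D$. Let $p>0$ and $s\ge0$ satisfy $s+p>1$. (a) There is a constant $C$, depending only on $p$ and $s$, such that every $\mu\in LCM_{p,s}$ is a Carleson measure for $D^p_{s+p-2}$, and the inclusion $I:D^p_{s+p-2}\to L^p(\mu)$ satisfies $\|I\|^p\le C\,\|\mu\|_{LCM_{p,s}}$, where $\|I\|=\sup\{\|f\|_{L^p(\mu)}:\|f\|_{D^p_{s+p-2}}\le1\}$. (b) If $\mu$ is finite on compact subsets of $D$ and is a vanishing $(p,s)$-logarithmic Carleson measure, then $\mu$ is a compact Carleson measure for $D^p_{s+p-2}$. -/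

import Mathlib

open MeasureTheory Filter Topology
open scoped NNReal ENNReal

namespace LogCarleson

/-- The open unit disk as a subset of the complex plane. -/
abbrev disk : Set ℂ := Metric.ball (0 : ℂ) 1

/-- The closed arc of the unit circle with centre `exp (i θ)` and normalized length `ℓ`
(the whole circle has length `1`). Every arc of length `ℓ` (open, closed, half-open) is contained
in the closed arc with the same centre and length, and Carleson boxes increase with the arc, so
suprema and limits over all arcs are the same as those over closed arcs. -/
def arc (θ ℓ : ℝ) : Set ℂ :=
  {ζ | ∃ φ : ℝ, |φ - θ| ≤ Real.pi * ℓ ∧ ζ = Complex.exp (φ * Complex.I)}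

/-- The Carleson box `S(I) = {z : 1 - |I| < |z| < 1, z / |z| ∈ I}` over the arc `I = arc θ ℓ`.
For the full circle (`ℓ = 1`) the box is the whole disk, the origin included. -/
def carlesonBox (θ ℓ : ℝ) : Set disk :=
  {z | (1 - ℓ < ‖(z : ℂ)‖ ∧ (z : ℂ) / (‖(z : ℂ)‖ : ℂ) ∈ arc θ ℓ) ∨ ℓ = 1}

/-- The quotient `|I|^{-s} (log (2 / |I|))^p μ(S(I))` for the arc `I = arc θ ℓ`. -/
noncomputable def lcmQuotient (p s : ℝ) (μ : Measure disk) (θ ℓ : ℝ) : ℝ≥0∞ :=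
  ENNReal.ofReal (1 / ℓ ^ s * Real.log (2 / ℓ) ^ p) * μ (carlesonBox θ ℓ)

/-- `‖μ‖_{LCM_{p,s}}`, the supremum of the quotients over all arcs (possibly infinite). -/
noncomputable def lcmNorm (p s : ℝ) (μ : Measure disk) : ℝ≥0∞ :=
  ⨆ (θ : ℝ) (ℓ : ℝ) (_ : 0 < ℓ ∧ ℓ ≤ 1), lcmQuotient p s μ θ ℓ

/-- `μ` is a `(p,s)`-logarithmic Carleson measure. -/
def IsLogCarleson (p s : ℝ) (μ : Measure disk) : Prop :=
  ∃ C : ℝ≥0, 0 < C ∧ lcmNorm p s μ ≤ C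

/-- The quotient tends to `0` as `|I| → 0`. -/
def IsVanishingLogCarleson (p s : ℝ) (μ : Measure disk) : Prop :=
  ∀ ε : ℝ≥0, 0 < ε → ∃ δ : ℝ, 0 < δ ∧
    ∀ θ ℓ : ℝ, 0 < ℓ → ℓ ≤ 1 → ℓ < δ → lcmQuotient p s μ θ ℓ < ε

/-- The measure `dA_α(z) = (α + 1) (1 - |z|^2)^α dA(z)` on the unit disk, where `dA` is the area
measure divided by `π`. -/
noncomputable def weightedArea (α : ℝ) : Measure ℂ :=
  ((ENNReal.ofReal Real.pi)⁻¹ • volume.restrict disk).withDensity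
    fun z => ENNReal.ofReal ((α + 1) * (1 - ‖z‖ ^ 2) ^ α)

/-- `‖f‖_{D^p_α} = |f(0)| + (∫_D |f'|^p dA_α)^{1/p}` (possibly infinite). -/
noncomputable def dirichletNorm (p α : ℝ) (f : ℂ → ℂ) : ℝ≥0∞ :=
  ‖f 0‖ₑ + (∫⁻ z, ‖deriv f z‖ₑ ^ p ∂(weightedArea α)) ^ (1 / p)

/-- `f` is (on the unit disk) an element of the weighted Dirichlet space `D^p_α`. -/
def MemDirichlet (p α : ℝ) (f : ℂ → ℂ) : Prop :=
  DifferentiableOn ℂ f disk ∧ dirichletNorm p α f < ∞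

/-- `‖f‖_{L^p(μ)} = (∫_D |f|^p dμ)^{1/p}` (possibly infinite). -/
noncomputable def lpNorm (p : ℝ) (μ : Measure disk) (f : ℂ → ℂ) : ℝ≥0∞ :=
  (∫⁻ z : disk, ‖f z‖ₑ ^ p ∂μ) ^ (1 / p)

/-- `μ` is a Carleson measure for `D^p_α`. -/
def IsCarlesonFor (p α : ℝ) (μ : Measure disk) : Prop :=
  ∃ C : ℝ≥0, 0 < C ∧ ∀ f : ℂ → ℂ, MemDirichlet p α f →
    ∫⁻ z : disk, ‖f z‖ₑ ^ p ∂μ ≤ C * dirichletNorm p α f ^ p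

/-- The norm of the inclusion `D^p_α → L^p(μ)` (possibly infinite): the supremum of
`‖f‖_{L^p(μ)}` over the unit ball of `D^p_α`. -/
noncomputable def inclusionNorm (p α : ℝ) (μ : Measure disk) : ℝ≥0∞ :=
  ⨆ (f : ℂ → ℂ) (_ : MemDirichlet p α f ∧ dirichletNorm p α f ≤ 1), lpNorm p μ f

/-- `μ` is a compact Carleson measure for `D^p_α`: `‖f_n‖_{L^p(μ)} → 0` for every bounded sequence
in `D^p_α` that converges to zero uniformly on compact subsets of the disk. -/
def IsCompactCarlesonFor (p α : ℝ) (μ : Measure disk) : Prop :=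
  ∀ f : ℕ → ℂ → ℂ, (∀ n, MemDirichlet p α (f n)) →
    (∃ M : ℝ≥0, ∀ n, dirichletNorm p α (f n) ≤ M) →
    (∀ K : Set ℂ, IsCompact K → K ⊆ disk → TendstoUniformlyOn f 0 atTop K) →
    Tendsto (fun n => lpNorm p μ (f n)) atTop (𝓝 0)

end LogCarleson

namespace LogCarleson

/-! Telescope f(z) - f(0) along the radius through z, over the points of modulus 1 - 2^{-k}. Since
|f'|^p satisfies a sub-mean-value inequality, the p-th power of the k-th increment is at most a
constant times 2^{-k(p-2)} times the integral of |f'|^p over a disk of Whitney size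
(`exists_enorm_rpow_radial_increment_le`). Passing from the p-th power of the sum to the sum of p-th
powers costs a weight (k+1)^p (`exists_rpow_sum_le_weighted_sum`).

Now integrate in μ and exchange the integrals. For fixed ζ, the points z beyond the k-th radius
whose k-th Whitney disk contains ζ lie in one Carleson box of length comparable to 2^{-k}, so they
have mass at most a constant times 2^{-ks} (k+1)^{-p} ‖μ‖. The logarithm in the LCM norm thus
cancels the weight (k+1)^p. What remains is the sum of 2^{-k(s+p-2)} over the boundedly many k with
2^{-k} comparable to 1 - |ζ|^2, which is dominated by the density of dA_{s+p-2}. The value f(0) is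
controlled by μ(D), the box over the full circle.

For (b), the estimate is linear in ‖μ‖. The restriction of a vanishing measure to r < |z| < 1 has
small LCM norm for r near 1, and uniform convergence handles the compact set |z| ≤ r. -/

/-! ### Sub-mean-value inequalities for powers of the modulus -/

theorem enorm_center_le_lintegral_circle {g : ℂ → ℂ} {c : ℂ} {r ρ : ℝ}
    (hg : DifferentiableOn ℂ g (Metric.ball c r)) (hρ : 0 < ρ) (hρr : ρ < r) :
    ENNReal.ofReal (2 * Real.pi) * ‖g c‖ₑ ≤
      ∫⁻ θ in Set.Ioo (-Real.pi) Real.pi, ‖g (circleMap c ρ θ)‖ₑ := by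
  have hsub : Metric.closedBall c ρ ⊆ Metric.ball c r := Metric.closedBall_subset_ball hρr
  have hd : DiffContOnCl ℂ g (Metric.ball c |ρ|) := by
    rw [abs_of_pos hρ]
    refine (hg.mono ?_).diffContOnCl
    exact (Metric.closure_ball_subset_closedBall).trans hsub
  have h1 := hd.circleAverage
  rw [Real.circleAverage_eq_integral_add (-Real.pi)] at h1
  rw [intervalIntegral.integral_comp_add_right (fun θ => g (circleMap c ρ θ))] at h1
  have h2 : (∫ θ in (0 + -Real.pi)..(2 * Real.pi + -Real.pi), g (circleMap c ρ θ))
      = ((2 * Real.pi : ℝ) : ℂ) * g c := by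
    rw [← h1, Complex.real_smul, ← mul_assoc, ← Complex.ofReal_mul,
      mul_inv_cancel₀ (by positivity)]
    simp
  rw [show (0 + -Real.pi) = -Real.pi by ring, show 2 * Real.pi + -Real.pi = Real.pi by ring,
    intervalIntegral.integral_of_le (by linarith [Real.pi_pos]), integral_Ioc_eq_integral_Ioo] at h2
  have h3 := enorm_integral_le_lintegral_enorm
    (μ := volume.restrict (Set.Ioo (-Real.pi) Real.pi)) (fun θ => g (circleMap c ρ θ))
  rw [h2, enorm_mul] at h3
  refine le_trans (le_of_eq ?_) h3
  congr 1
  rw [← ofReal_norm, Complex.norm_real, Real.norm_of_nonneg (by positivity)]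

theorem enorm_center_le_lintegral_ball {g : ℂ → ℂ} {c : ℂ} {r : ℝ} (hgm : Measurable g)
    (hg : DifferentiableOn ℂ g (Metric.ball c r)) (hr : 0 < r) :
    ENNReal.ofReal (r ^ 2) * ‖g c‖ₑ ≤ ∫⁻ z in Metric.ball c r, ‖g z‖ₑ := by
  set F : ℂ → ℝ≥0∞ := (Metric.ball c r).indicator (fun z => ‖g z‖ₑ) with hF
  have hFm : Measurable F := hgm.enorm.indicator Metric.isOpen_ball.measurableSet
  have h0 : ∫⁻ z in Metric.ball c r, ‖g z‖ₑ = ∫⁻ w, F (c + w) := by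
    rw [lintegral_add_left_eq_self F c, hF, lintegral_indicator Metric.isOpen_ball.measurableSet]
  have hm : Measurable (fun q : ℝ × ℝ => ENNReal.ofReal q.1 • F (c + Complex.polarCoord.symm q)) := by
    refine Measurable.smul (ENNReal.measurable_ofReal.comp measurable_fst) (hFm.comp ?_)
    simp only [Complex.polarCoord_symm_apply]
    fun_prop
  rw [h0, ← Complex.lintegral_comp_polarCoord_symm, polarCoord_target, Measure.volume_eq_prod,
    ← Measure.prod_restrict, lintegral_prod _ hm.aemeasurable]
  have hpt : ∀ ρ θ : ℝ, c + Complex.polarCoord.symm (ρ, θ) = circleMap c ρ θ := by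
    intro ρ θ
    rw [Complex.polarCoord_symm_apply, circleMap, Complex.exp_mul_I]
    simp
  simp only [hpt, smul_eq_mul]
  -- Only the radii in (r/2, r) are kept, where the Jacobian ρ is at least r/2. This gives
  -- (r/2)(r/2)(2π) = πr²/2 ≥ r².
  calc ENNReal.ofReal (r ^ 2) * ‖g c‖ₑ
      ≤ ∫⁻ ρ in Set.Ioo (r / 2) r, ENNReal.ofReal (r / 2) *
          (ENNReal.ofReal (2 * Real.pi) * ‖g c‖ₑ) := by
        rw [setLIntegral_const, Real.volume_Ioo, mul_comm _ (ENNReal.ofReal (r - r / 2)),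
          ← mul_assoc, ← mul_assoc, ← ENNReal.ofReal_mul (by linarith),
          ← ENNReal.ofReal_mul (by nlinarith)]
        gcongr
        nlinarith [Real.pi_gt_three, sq_nonneg r]
    _ ≤ ∫⁻ ρ in Set.Ioo (r / 2) r, ∫⁻ θ in Set.Ioo (-Real.pi) Real.pi,
          ENNReal.ofReal ρ * F (circleMap c ρ θ) := by
        refine setLIntegral_mono' measurableSet_Ioo fun ρ hρ => ?_
        have hρ0 : 0 < ρ := by linarith [hρ.1]
        rw [lintegral_const_mul' _ _ ENNReal.ofReal_ne_top]
        refine mul_le_mul' (ENNReal.ofReal_le_ofReal hρ.1.le) ?_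
        refine (enorm_center_le_lintegral_circle hg hρ0 hρ.2).trans (le_of_eq ?_)
        refine lintegral_congr fun θ => ?_
        rw [hF, Set.indicator_of_mem]
        simp [circleMap, abs_of_pos hρ0, hρ.2]
    _ ≤ _ := lintegral_mono_set fun ρ hρ => by
        have := hρ.1
        simp only [Set.mem_Ioi]
        linarith

/-- Subharmonicity of |g|^p is replaced by a maximum argument. Let z maximise (r/2 - |w-c|)^{2/p}
|g(w)| and let δ = r/2 - |z-c|. On the disk of radius δ/2 about z, |g| is at most 2^{2/p} |g(z)|, so
|g| ≤ K |g(z)|^{1-p} |g|^p there. The mean value inequality at z then bounds δ² |g(z)|^p, and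
maximality carries the bound back to c. The exponent 2/p makes the p-th power of the weight
quadratic, matching area. -/
theorem enorm_rpow_center_le_lintegral_ball_of_le_one {p : ℝ} (hp : 0 < p) (hp1 : p ≤ 1)
    {g : ℂ → ℂ} {c : ℂ} {r : ℝ} (hgm : Measurable g)
    (hg : DifferentiableOn ℂ g (Metric.ball c r)) (hr : 0 < r) :
    ENNReal.ofReal (r ^ 2) * ‖g c‖ₑ ^ p ≤
      ENNReal.ofReal (16 * (2 ^ (2 / p)) ^ (1 - p)) * ∫⁻ z in Metric.ball c r, ‖g z‖ₑ ^ p := by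
  have hR : 0 < r / 2 := by linarith
  have hsub : Metric.closedBall c (r / 2) ⊆ Metric.ball c r :=
    Metric.closedBall_subset_ball (by linarith)
  have hp2 : 0 ≤ 2 / p := by positivity
  obtain ⟨z, hz, hmax⟩ := (isCompact_closedBall c (r / 2)).exists_isMaxOn
    ⟨c, Metric.mem_closedBall_self hR.le⟩
    (f := fun w => (r / 2 - dist w c) ^ (2 / p) * ‖g w‖) (by
      refine ContinuousOn.mul ?_ (hg.continuousOn.mono hsub).norm
      exact (Continuous.rpow_const (by fun_prop) fun _ => Or.inr hp2).continuousOn)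
  have hzc : dist z c ≤ r / 2 := hz
  set δ := r / 2 - dist z c with hδ
  have hδ0 : 0 ≤ δ := by linarith
  have hmax' : ∀ w ∈ Metric.closedBall c (r / 2),
      (r / 2 - dist w c) ^ (2 / p) * ‖g w‖ ≤ δ ^ (2 / p) * ‖g z‖ := fun w hw => hmax hw
  have hc := hmax' c (Metric.mem_closedBall_self hR.le)
  rw [dist_self, sub_zero] at hc
  rcases eq_or_ne (g c) 0 with h0 | h0
  · simp [h0, hp]
  have hpos : 0 < δ ^ (2 / p) * ‖g z‖ :=
    lt_of_lt_of_le (mul_pos (Real.rpow_pos_of_pos hR _) (norm_pos_iff.2 h0)) hc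
  have hgz : 0 < ‖g z‖ := by
    rcases (norm_nonneg (g z)).eq_or_lt with h | h
    · rw [← h, mul_zero] at hpos; exact absurd hpos (lt_irrefl _)
    · exact h
  have hδpos : 0 < δ := by
    rcases hδ0.eq_or_lt with h | h
    · rw [← h, Real.zero_rpow (by positivity), zero_mul] at hpos
      exact absurd hpos (lt_irrefl _)
    · exact h
  have hball : Metric.ball z (δ / 2) ⊆ Metric.ball c r := by
    refine Metric.ball_subset_ball' ?_
    linarith
  set K : ℝ := (2 ^ (2 / p)) ^ (1 - p) with hK
  have hK0 : 0 < K := by positivity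
  have hw : ∀ w ∈ Metric.ball z (δ / 2), ‖g w‖ₑ ≤
      ENNReal.ofReal (K * ‖g z‖ ^ (1 - p)) * ‖g w‖ₑ ^ p := by
    intro w hw
    have hwz : dist w z < δ / 2 := hw
    have hwc : dist w c ≤ dist w z + dist z c := dist_triangle _ _ _
    have h1 := hmax' w (by rw [Metric.mem_closedBall]; linarith)
    have h2 : (δ / 2) ^ (2 / p) * ‖g w‖ ≤ δ ^ (2 / p) * ‖g z‖ := by
      refine le_trans ?_ h1
      gcongr
      linarith
    have h3 : ‖g w‖ ≤ 2 ^ (2 / p) * ‖g z‖ := by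
      have e : δ ^ (2 / p) = (δ / 2) ^ (2 / p) * 2 ^ (2 / p) := by
        rw [← Real.mul_rpow (by positivity) (by norm_num)]; congr 1; ring
      rw [e, mul_assoc] at h2
      exact le_of_mul_le_mul_left h2 (by positivity)
    have h4 : ‖g w‖ ≤ K * ‖g z‖ ^ (1 - p) * ‖g w‖ ^ p := by
      rcases (norm_nonneg (g w)).eq_or_lt with h | h
      · rw [← h]; positivity
      calc ‖g w‖ = ‖g w‖ ^ (1 - p) * ‖g w‖ ^ p := by
            rw [← Real.rpow_add h]; simp
        _ ≤ (2 ^ (2 / p) * ‖g z‖) ^ (1 - p) * ‖g w‖ ^ p := by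
            gcongr
        _ = _ := by rw [Real.mul_rpow (by positivity) hgz.le]
    rw [← ofReal_norm (g w), ENNReal.ofReal_rpow_of_nonneg (norm_nonneg _) hp.le,
      ← ENNReal.ofReal_mul (by positivity)]
    exact ENNReal.ofReal_le_ofReal h4
  have hmv := enorm_center_le_lintegral_ball hgm (hg.mono hball) (half_pos hδpos)
  have hA : ENNReal.ofReal ((δ / 2) ^ 2) * ‖g z‖ₑ ≤ ENNReal.ofReal (K * ‖g z‖ ^ (1 - p)) *
      ∫⁻ w in Metric.ball c r, ‖g w‖ₑ ^ p := by
    refine hmv.trans ((setLIntegral_mono' Metric.isOpen_ball.measurableSet hw).trans ?_)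
    rw [lintegral_const_mul' _ _ ENNReal.ofReal_ne_top]
    gcongr
  have hcp : (r / 2) ^ 2 * ‖g c‖ ^ p ≤ δ ^ 2 * ‖g z‖ ^ p := by
    have h := Real.rpow_le_rpow (by positivity) hc hp.le
    rw [Real.mul_rpow (by positivity) (by positivity), Real.mul_rpow (by positivity) (by positivity),
      ← Real.rpow_mul (by positivity), ← Real.rpow_mul (by positivity),
      div_mul_cancel₀ _ hp.ne'] at h
    exact_mod_cast h
  have hfin : ENNReal.ofReal (‖g z‖ ^ (1 - p)) ≠ 0 := by
    rw [Ne, ENNReal.ofReal_eq_zero, not_le]; positivity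
  -- Multiplying by |g(z)|^{1-p} lets the mean value bound at z apply directly. The constant 16 is 4
  -- from (r/2)² times 4 from (δ/2)².
  rw [← ENNReal.mul_le_mul_iff_right hfin ENNReal.ofReal_ne_top]
  calc ENNReal.ofReal (‖g z‖ ^ (1 - p)) * (ENNReal.ofReal (r ^ 2) * ‖g c‖ₑ ^ p)
      = ENNReal.ofReal (‖g z‖ ^ (1 - p) * (4 * ((r / 2) ^ 2 * ‖g c‖ ^ p))) := by
        rw [← ofReal_norm (g c), ENNReal.ofReal_rpow_of_nonneg (norm_nonneg _) hp.le,
          ← ENNReal.ofReal_mul (by positivity), ← ENNReal.ofReal_mul (by positivity)]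
        congr 1; ring
    _ ≤ ENNReal.ofReal (‖g z‖ ^ (1 - p) * (4 * (δ ^ 2 * ‖g z‖ ^ p))) := by gcongr
    _ = ENNReal.ofReal 16 * (ENNReal.ofReal ((δ / 2) ^ 2) * ‖g z‖ₑ) := by
        rw [← ofReal_norm (g z), ← ENNReal.ofReal_mul (by positivity),
          ← ENNReal.ofReal_mul (by positivity)]
        congr 1
        have : ‖g z‖ = ‖g z‖ ^ (1 - p) * ‖g z‖ ^ p := by rw [← Real.rpow_add hgz]; simp
        calc _ = 4 * δ ^ 2 * (‖g z‖ ^ (1 - p) * ‖g z‖ ^ p) := by ring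
          _ = 4 * δ ^ 2 * ‖g z‖ := by rw [← this]
          _ = _ := by ring
    _ ≤ ENNReal.ofReal 16 * (ENNReal.ofReal (K * ‖g z‖ ^ (1 - p)) *
          ∫⁻ w in Metric.ball c r, ‖g w‖ₑ ^ p) := by gcongr
    _ = _ := by
        rw [ENNReal.ofReal_mul hK0.le, ENNReal.ofReal_mul (by norm_num : (0:ℝ) ≤ 16)]
        ring

/-- The `p`-th power of the modulus of a holomorphic function at the centre of a disk is at most
a constant times its average over the disk. -/
theorem exists_enorm_rpow_center_le_lintegral_ball {p : ℝ} (hp : 0 < p) :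
    ∃ C : ℝ≥0, ∀ (g : ℂ → ℂ) (c : ℂ) (r : ℝ), Measurable g →
      DifferentiableOn ℂ g (Metric.ball c r) → 0 < r →
      ENNReal.ofReal (r ^ 2) * ‖g c‖ₑ ^ p ≤ C * ∫⁻ z in Metric.ball c r, ‖g z‖ₑ ^ p := by
  obtain ⟨n, hn⟩ := exists_nat_gt p
  have hn0 : (0 : ℝ) < n := hp.trans hn
  -- Since n > p, the exponent q is below 1, and the previous case applies to the holomorphic
  -- function g^n.
  set q : ℝ := p / n
  refine ⟨(16 * (2 ^ (2 / q)) ^ (1 - q) : ℝ).toNNReal, fun g c r hgm hg hr => ?_⟩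
  have h := enorm_rpow_center_le_lintegral_ball_of_le_one (p := q) (by positivity)
    ((div_le_one hn0).2 hn.le) (hgm.pow_const n) (hg.pow n) hr
  have e : ∀ z, ‖g z ^ n‖ₑ ^ q = ‖g z‖ₑ ^ p := fun z => by
    rw [enorm_pow, ← ENNReal.rpow_natCast, ← ENNReal.rpow_mul, mul_div_cancel₀ _ hn0.ne']
  simp only [e] at h
  exact h

/-! ### Radial telescoping over Whitney disks -/

/-- For p ≤ 1 this is subadditivity of the power. For p > 1 it is Hölder's inequality against
1/(k+1), which lies in ℓ^q because the conjugate exponent q exceeds 1. -/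
theorem exists_rpow_sum_le_weighted_sum {p : ℝ} (hp : 0 < p) :
    ∃ C : ℝ≥0, ∀ (n : ℕ) (d : ℕ → ℝ≥0∞), (∑ k ∈ Finset.range n, d k) ^ p ≤
      C * ∑ k ∈ Finset.range n, ((k : ℝ≥0∞) + 1) ^ p * d k ^ p := by
  rcases le_or_gt p 1 with hp1 | hp1
  · refine ⟨1, fun n d => ?_⟩
    rw [ENNReal.coe_one, one_mul]
    refine (Finset.le_sum_of_subadditive (fun x : ℝ≥0∞ => x ^ p) (by simp [hp])
      (fun x y => ENNReal.rpow_add_le_add_rpow x y hp.le hp1) _ _).trans ?_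
    refine Finset.sum_le_sum fun k _ => le_mul_of_one_le_left' ?_
    exact ENNReal.one_le_rpow (by simp) hp
  · set q := p.conjExponent
    have hpq : p.HolderConjugate q := Real.HolderConjugate.conjExponent hp1
    have hq : 1 < q := hpq.symm.lt
    have hsum : Summable fun k : ℕ => (((k : ℝ≥0) + 1)⁻¹) ^ q := by
      have h : Summable fun k : ℕ => (((k + 1 : ℕ) : ℝ≥0) ^ q)⁻¹ :=
        NNReal.summable_comp_injective (NNReal.summable_rpow_inv.2 hq) (add_left_injective 1)
      refine h.congr fun k => ?_
      rw [NNReal.inv_rpow, Nat.cast_add_one]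
    set A : ℝ≥0 := ∑' k : ℕ, (((k : ℝ≥0) + 1)⁻¹) ^ q
    refine ⟨A ^ (p / q), fun n d => ?_⟩
    have h1 := ENNReal.inner_le_Lp_mul_Lq (Finset.range n)
      (fun k : ℕ => ((((k : ℝ≥0) + 1)⁻¹ : ℝ≥0) : ℝ≥0∞)) (fun k => ((k : ℝ≥0∞) + 1) * d k) hpq.symm
    have h2 : ∀ k : ℕ, ((((k : ℝ≥0) + 1)⁻¹ : ℝ≥0) : ℝ≥0∞) * (((k : ℝ≥0∞) + 1) * d k) = d k := by
      intro k
      rw [ENNReal.coe_inv (by positivity), ← mul_assoc]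
      push_cast
      rw [ENNReal.inv_mul_cancel (by simp) (by finiteness), one_mul]
    simp only [h2] at h1
    have h3 : ∑ k ∈ Finset.range n, ((((k : ℝ≥0) + 1)⁻¹ : ℝ≥0) : ℝ≥0∞) ^ q ≤ A := by
      simp_rw [← ENNReal.coe_rpow_of_nonneg _ hpq.symm.nonneg]
      rw [← ENNReal.ofNNReal_finsetSum]
      exact ENNReal.coe_le_coe.2 (hsum.sum_le_tsum _ fun _ _ => zero_le)
    calc (∑ k ∈ Finset.range n, d k) ^ p
        ≤ ((A : ℝ≥0∞) ^ (1 / q) * (∑ k ∈ Finset.range n, (((k : ℝ≥0∞) + 1) * d k) ^ p) ^ (1 / p)) ^ p := by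
          refine ENNReal.rpow_le_rpow (h1.trans ?_) hp.le
          gcongr
      _ = _ := by
          rw [ENNReal.mul_rpow_of_nonneg _ _ hp.le, ← ENNReal.rpow_mul, ← ENNReal.rpow_mul,
            one_div_mul_cancel hp.ne', ENNReal.rpow_one,
            ENNReal.coe_rpow_of_nonneg _ (by have := hpq.symm.nonneg; positivity), one_div_mul_eq_div]
          simp_rw [ENNReal.mul_rpow_of_nonneg _ _ hp.le]

/-- The increment is at most h times |f'| at the point of the segment where |f'| is largest. The
disk of radius h/4 about that point stays in the unit disk and, the segment having length at most
h/2, in the disk of radius 3h/4 about (1-h)e. The sub-mean-value inequality there turns h^p into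
h^{p-2} times an integral. -/
theorem exists_enorm_rpow_radial_increment_le {p : ℝ} (hp : 0 < p) :
    ∃ C : ℝ≥0, ∀ (f : ℂ → ℂ), DifferentiableOn ℂ f disk → ∀ (e : ℂ) (h ρ : ℝ), ‖e‖ = 1 → 0 < h →
      h ≤ 1 → 1 - h ≤ ρ → ρ ≤ 1 - h / 2 →
      ‖f (ρ * e) - f (((1 - h : ℝ) : ℂ) * e)‖ₑ ^ p ≤ C * (ENNReal.ofReal (h ^ (p - 2)) *
        ∫⁻ ζ in Metric.ball (((1 - h : ℝ) : ℂ) * e) (3 / 4 * h), ‖deriv f ζ‖ₑ ^ p) := by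
  obtain ⟨C, hC⟩ := exists_enorm_rpow_center_le_lintegral_ball hp
  refine ⟨16 * C, fun f hf e h ρ he hh hh1 hρ1 hρ2 => ?_⟩
  have hfd : DifferentiableOn ℂ (deriv f) disk := hf.deriv Metric.isOpen_ball
  set a : ℂ := ((1 - h : ℝ) : ℂ) * e with ha
  set S : Set ℂ := (fun σ : ℝ => (σ : ℂ) * e) '' Set.Icc (1 - h) ρ with hS
  have hnorm : ∀ σ ∈ Set.Icc (1 - h) ρ, ‖(σ : ℂ) * e‖ = σ := fun σ hσ => by
    rw [norm_mul, he, mul_one, Complex.norm_real, Real.norm_of_nonneg (by linarith [hσ.1])]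
  have hSd : S ⊆ disk := by
    rintro _ ⟨σ, hσ, rfl⟩
    rw [mem_ball_zero_iff, hnorm σ hσ]
    linarith [hσ.2]
  have hSc : IsCompact S := isCompact_Icc.image (by fun_prop)
  have hSv : Convex ℝ S := by
    have : S = (LinearMap.toSpanSingleton ℝ ℂ e) '' Set.Icc (1 - h) ρ := by
      rw [hS]; congr 1
    rw [this]
    exact (convex_Icc _ _).linear_image _
  have haS : a ∈ S := ⟨1 - h, ⟨le_rfl, hρ1⟩, rfl⟩
  have hbS : (ρ : ℂ) * e ∈ S := ⟨ρ, ⟨hρ1, le_rfl⟩, rfl⟩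
  obtain ⟨w, hwS, hw⟩ := hSc.exists_isMaxOn ⟨a, haS⟩ (f := fun w => ‖deriv f w‖)
    (hfd.continuousOn.mono hSd).norm
  have hmv : ‖f (ρ * e) - f a‖ ≤ ‖deriv f w‖ * ‖(ρ : ℂ) * e - a‖ :=
    hSv.norm_image_sub_le_of_norm_deriv_le
      (fun x hx => hf.differentiableAt (Metric.isOpen_ball.mem_nhds (hSd hx)))
      (fun x hx => hw hx) haS hbS
  obtain ⟨σ, hσ, rfl⟩ := hwS
  have hdist : ∀ τ : ℝ, ‖(τ : ℂ) * e - a‖ = |τ - (1 - h)| := fun τ => by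
    rw [ha, ← sub_mul, ← Complex.ofReal_sub, norm_mul, he, mul_one, Complex.norm_real,
      Real.norm_eq_abs]
  have hb1 : Metric.ball ((σ : ℂ) * e) (h / 4) ⊆ disk := by
    refine Metric.ball_subset_ball' ?_
    rw [dist_zero_right, hnorm σ hσ]
    linarith [hσ.2]
  have hb2 : Metric.ball ((σ : ℂ) * e) (h / 4) ⊆ Metric.ball a (3 / 4 * h) := by
    refine Metric.ball_subset_ball' ?_
    rw [dist_eq_norm, hdist, abs_of_nonneg (by linarith [hσ.1])]
    linarith [hσ.2]
  have hsm := hC (deriv f) _ _ (measurable_deriv f) (hfd.mono hb1) (by positivity : 0 < h / 4)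
  have hstep : ‖f (ρ * e) - f a‖ ≤ h * ‖deriv f (σ * e)‖ := by
    refine hmv.trans ?_
    rw [hdist, abs_of_nonneg (by linarith), mul_comm]
    gcongr
    linarith
  calc ‖f (ρ * e) - f a‖ₑ ^ p
      ≤ (ENNReal.ofReal h * ‖deriv f (σ * e)‖ₑ) ^ p := by
        refine ENNReal.rpow_le_rpow ?_ hp.le
        rw [← ofReal_norm, ← ofReal_norm (deriv f _), ← ENNReal.ofReal_mul hh.le]
        exact ENNReal.ofReal_le_ofReal hstep
    _ = 16 * ENNReal.ofReal (h ^ (p - 2)) *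
          (ENNReal.ofReal ((h / 4) ^ 2) * ‖deriv f (σ * e)‖ₑ ^ p) := by
        rw [ENNReal.mul_rpow_of_nonneg _ _ hp.le, ENNReal.ofReal_rpow_of_nonneg hh.le hp.le,
          ← mul_assoc]
        congr 1
        rw [show (16 : ℝ≥0∞) = ENNReal.ofReal 16 by simp, ← ENNReal.ofReal_mul (by norm_num),
          ← ENNReal.ofReal_mul (by positivity)]
        congr 1
        rw [Real.rpow_sub hh, Real.rpow_two]
        field_simp
        norm_num
    _ ≤ 16 * ENNReal.ofReal (h ^ (p - 2)) *
          (C * ∫⁻ ζ in Metric.ball a (3 / 4 * h), ‖deriv f ζ‖ₑ ^ p) := by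
        exact mul_le_mul_right (hsm.trans (mul_le_mul_right (lintegral_mono_set hb2) _)) _
    _ = _ := by push_cast; ring

/-- The `k`-th disk of Whitney size along the radius towards `z`. -/
def whitneyBall (k : ℕ) (z : ℂ) : Set ℂ :=
  Metric.ball (((1 - (1 / 2) ^ k : ℝ) : ℂ) * (z / (‖z‖ : ℂ))) (3 / 4 * (1 / 2) ^ k)

theorem exists_enorm_rpow_sub_le_tsum {p : ℝ} (hp : 0 < p) :
    ∃ C : ℝ≥0, ∀ (f : ℂ → ℂ), DifferentiableOn ℂ f disk → ∀ z ∈ disk,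
      ‖f z - f 0‖ₑ ^ p ≤ C * ∑' k : ℕ, ((k : ℝ≥0∞) + 1) ^ p *
        (ENNReal.ofReal (((1 / 2 : ℝ) ^ k) ^ (p - 2)) *
          {w : ℂ | 1 - (1 / 2 : ℝ) ^ k < ‖w‖}.indicator
            (fun w => ∫⁻ ζ in whitneyBall k w, ‖deriv f ζ‖ₑ ^ p) z) := by
  obtain ⟨C₁, hC₁⟩ := exists_rpow_sum_le_weighted_sum hp
  obtain ⟨C₂, hC₂⟩ := exists_enorm_rpow_radial_increment_le hp
  refine ⟨C₁ * C₂, fun f hf z hz => ?_⟩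
  have hz1 : ‖z‖ < 1 := by simpa using hz
  rcases eq_or_ne z 0 with rfl | hz0
  · simp [hp]
  have hzn : (‖z‖ : ℂ) ≠ 0 := by exact_mod_cast norm_ne_zero_iff.2 hz0
  set e : ℂ := z / (‖z‖ : ℂ) with he
  have he1 : ‖e‖ = 1 := by
    rw [he, norm_div, Complex.norm_real, norm_norm, div_self (norm_ne_zero_iff.2 hz0)]
  have hez : (‖z‖ : ℂ) * e = z := mul_div_cancel₀ _ hzn
  -- Cutting off at |z| makes the chain reach z after finitely many steps. The increments vanish
  -- once 1 - 2^{-k} ≥ |z|, which is what the indicator records.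
  set ρ : ℕ → ℝ := fun k => min (1 - (1 / 2 : ℝ) ^ k) ‖z‖ with hρ
  have hh : ∀ k : ℕ, (0 : ℝ) < (1 / 2) ^ k := fun k => by positivity
  obtain ⟨n, hn⟩ := exists_pow_lt_of_lt_one (sub_pos.2 hz1) (by norm_num : (1 / 2 : ℝ) < 1)
  have hρ0 : ρ 0 = 0 := by simp [hρ]
  have hρn : ρ n = ‖z‖ := min_eq_right (by linarith)
  have htel : f z - f 0 = ∑ k ∈ Finset.range n, (f (ρ (k + 1) * e) - f (ρ k * e)) := by
    rw [Finset.sum_range_sub (fun k => f (ρ k * e)), hρ0, hρn, hez]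
    simp
  have hstep : ∀ k, ‖f (ρ (k + 1) * e) - f (ρ k * e)‖ₑ ^ p ≤
      C₂ * (ENNReal.ofReal (((1 / 2 : ℝ) ^ k) ^ (p - 2)) *
          {w : ℂ | 1 - (1 / 2 : ℝ) ^ k < ‖w‖}.indicator
            (fun w => ∫⁻ ζ in whitneyBall k w, ‖deriv f ζ‖ₑ ^ p) z) := by
    intro k
    have hpow : (1 / 2 : ℝ) ^ (k + 1) = (1 / 2) ^ k / 2 := by ring
    by_cases hk : 1 - (1 / 2 : ℝ) ^ k < ‖z‖
    · rw [Set.indicator_of_mem (by exact hk)]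
      have h1 : ρ k = 1 - (1 / 2) ^ k := min_eq_left hk.le
      rw [h1]
      refine hC₂ f hf e _ _ he1 (hh k) (pow_le_one₀ (by norm_num) (by norm_num)) ?_ ?_
      · refine le_min ?_ hk.le
        rw [hpow]; linarith [hh k]
      · exact (min_le_left _ _).trans (by rw [hpow])
    · have h1 : ρ k = ‖z‖ := min_eq_right (not_lt.1 hk)
      have h2 : ρ (k + 1) = ‖z‖ := min_eq_right (by rw [hpow]; linarith [hh k])
      simp [h1, h2, hp]
  calc ‖f z - f 0‖ₑ ^ p
      ≤ (∑ k ∈ Finset.range n, ‖f (ρ (k + 1) * e) - f (ρ k * e)‖ₑ) ^ p := by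
        rw [htel]
        exact ENNReal.rpow_le_rpow (enorm_sum_le _ _) hp.le
    _ ≤ C₁ * ∑ k ∈ Finset.range n, ((k : ℝ≥0∞) + 1) ^ p *
          ‖f (ρ (k + 1) * e) - f (ρ k * e)‖ₑ ^ p := hC₁ _ _
    _ ≤ C₁ * ∑ k ∈ Finset.range n, C₂ * (((k : ℝ≥0∞) + 1) ^ p *
          (ENNReal.ofReal (((1 / 2 : ℝ) ^ k) ^ (p - 2)) *
          {w : ℂ | 1 - (1 / 2 : ℝ) ^ k < ‖w‖}.indicator
            (fun w => ∫⁻ ζ in whitneyBall k w, ‖deriv f ζ‖ₑ ^ p) z)) := by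
        refine mul_le_mul_right (Finset.sum_le_sum fun k _ => ?_) _
        rw [mul_left_comm]
        exact mul_le_mul_right (hstep k) _
    _ ≤ _ := by
        rw [← Finset.mul_sum, ← mul_assoc, ENNReal.coe_mul]
        gcongr
        exact ENNReal.sum_le_tsum _

/-! ### Carleson boxes and the mass seen from a point ζ -/

theorem lcmQuotient_le_lcmNorm (p s : ℝ) (μ : Measure disk) (θ : ℝ) {ℓ : ℝ} (h0 : 0 < ℓ)
    (h1 : ℓ ≤ 1) : lcmQuotient p s μ θ ℓ ≤ lcmNorm p s μ :=
  le_iSup_of_le θ (le_iSup_of_le ℓ (le_iSup_of_le ⟨h0, h1⟩ le_rfl))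

theorem norm_div_norm_le_one (z : ℂ) : ‖z / (‖z‖ : ℂ)‖ ≤ 1 := by
  rw [norm_div, Complex.norm_real, norm_norm]
  exact div_self_le_one _

/-- An angle is at most π/2 times its chord, and an arc of normalized length h reaches πh to each
side of its centre. -/
theorem mem_arc_of_norm_sub_le {e e₀ : ℂ} {h : ℝ} (he : ‖e‖ = 1) (he₀ : ‖e₀‖ = 1)
    (hd : ‖e - e₀‖ ≤ 2 * h) : e ∈ arc e₀.arg h := by
  have h0 : e ≠ 0 := norm_ne_zero_iff.1 (by rw [he]; exact one_ne_zero)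
  have h0' : e₀ ≠ 0 := norm_ne_zero_iff.1 (by rw [he₀]; exact one_ne_zero)
  refine ⟨e₀.arg + (e / e₀).arg, ?_, ?_⟩
  · rw [add_sub_cancel_left, ← Complex.angle_eq_abs_arg h0 h0']
    refine (Complex.angle_le_mul_norm_sub he he₀).trans ?_
    calc Real.pi / 2 * ‖e - e₀‖ ≤ Real.pi / 2 * (2 * h) := by gcongr
      _ = Real.pi * h := by ring
  · have h1 := Complex.norm_mul_exp_arg_mul_I e₀
    have h2 := Complex.norm_mul_exp_arg_mul_I (e / e₀)
    rw [norm_div, he, he₀] at h2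
    rw [he₀] at h1
    simp only [div_one, Complex.ofReal_one, one_mul] at h1 h2
    rw [Complex.ofReal_add, add_mul, Complex.exp_add, h1, h2, mul_div_cancel₀ _ h0']

/-- With η = 2^{-(k+1)}, two such points have directions e, e₀ with (1-η)|e-e₀| < 3η/2. Since 1-η ≥
1/2, this gives |e-e₀| < 3η ≤ 2·2^{-k}, so the arc of length 2^{-k} around the direction of any one
of the points contains the others. The shift from k+1 to k keeps the length at most 1. -/
theorem exists_setOf_mem_whitneyBall_subset_carlesonBox (k : ℕ) (ζ : ℂ) :
    ∃ θ : ℝ, {z : disk | 1 - (1 / 2 : ℝ) ^ (k + 1) < ‖(z : ℂ)‖ ∧ ζ ∈ whitneyBall (k + 1) z} ⊆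
      carlesonBox θ ((1 / 2) ^ k) := by
  rcases Set.eq_empty_or_nonempty
    {z : disk | 1 - (1 / 2 : ℝ) ^ (k + 1) < ‖(z : ℂ)‖ ∧ ζ ∈ whitneyBall (k + 1) z} with h | ⟨z₀, hz₀⟩
  · exact ⟨0, by rw [h]; exact Set.empty_subset _⟩
  have hk : (1 / 2 : ℝ) ^ (k + 1) = (1 / 2) ^ k / 2 := by ring
  have hk0 : (0 : ℝ) < (1 / 2) ^ k := by positivity
  have hk1 : (1 / 2 : ℝ) ^ k ≤ 1 := pow_le_one₀ (by norm_num) (by norm_num)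
  have hunit : ∀ z : disk, 1 - (1 / 2 : ℝ) ^ (k + 1) < ‖(z : ℂ)‖ → ‖(z : ℂ) / (‖(z : ℂ)‖ : ℂ)‖ = 1 := by
    intro z hz
    have : ‖(z : ℂ)‖ ≠ 0 := by rw [hk] at hz; linarith
    rw [norm_div, Complex.norm_real, norm_norm, div_self this]
  refine ⟨((z₀ : ℂ) / (‖(z₀ : ℂ)‖ : ℂ)).arg, fun z hz => Or.inl ⟨?_, ?_⟩⟩
  · have := hz.1
    rw [hk] at this; linarith
  · refine mem_arc_of_norm_sub_le (hunit z hz.1) (hunit z₀ hz₀.1) ?_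
    set e := (z : ℂ) / (‖(z : ℂ)‖ : ℂ)
    set e₀ := (z₀ : ℂ) / (‖(z₀ : ℂ)‖ : ℂ)
    have h1 : dist ζ _ < _ := hz.2
    have h2 : dist ζ _ < _ := hz₀.2
    have h3 := dist_triangle_left (((1 - (1 / 2) ^ (k + 1) : ℝ) : ℂ) * e)
      (((1 - (1 / 2) ^ (k + 1) : ℝ) : ℂ) * e₀) ζ
    have h4 : dist (((1 - (1 / 2) ^ (k + 1) : ℝ) : ℂ) * e)
      (((1 - (1 / 2) ^ (k + 1) : ℝ) : ℂ) * e₀) = (1 - (1 / 2) ^ (k + 1)) * ‖e - e₀‖ := by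
      rw [dist_eq_norm, ← mul_sub, norm_mul, Complex.norm_real, Real.norm_of_nonneg]
      rw [hk]; linarith
    rw [h4] at h3
    rw [hk] at h1 h2 h3
    nlinarith [norm_nonneg (e - e₀)]

theorem rpow_mul_measure_univ_le (p s : ℝ) (μ : Measure disk) :
    ENNReal.ofReal (Real.log 2 ^ p) * μ Set.univ ≤ lcmNorm p s μ := by
  have h := lcmQuotient_le_lcmNorm p s μ 0 one_pos le_rfl
  have h1 : carlesonBox 0 1 = Set.univ := Set.eq_univ_of_forall fun z => Or.inr rfl
  simpa [lcmQuotient, h1] using h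

theorem rpow_mul_measure_setOf_mem_whitneyBall_le {p s : ℝ} (hp : 0 < p) (hs : 0 ≤ s)
    (μ : Measure disk) (k : ℕ) (ζ : ℂ) :
    ((k : ℝ≥0∞) + 1) ^ p *
        μ {z : disk | 1 - (1 / 2 : ℝ) ^ k < ‖(z : ℂ)‖ ∧ ζ ∈ whitneyBall k z} ≤
      ENNReal.ofReal (2 ^ s * (2 / Real.log 2) ^ p) * ENNReal.ofReal (((1 / 2 : ℝ) ^ k) ^ s) *
        lcmNorm p s μ := by
  have hl : 0 < Real.log 2 := Real.log_pos (by norm_num)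
  -- Here c is the factor in front of the mass in the LCM quotient. Generation 0 uses the full
  -- circle. Generation k+1 uses length 2^{-k}, where log(2/2^{-k}) = (k+1) log 2. The loss 2^s
  -- comes from doubling the length, and 2^p from k+2 ≤ 2(k+1).
  obtain ⟨c, hc0, hc, hle⟩ : ∃ c : ℝ, 0 ≤ c ∧ ENNReal.ofReal c *
      μ {z : disk | 1 - (1 / 2 : ℝ) ^ k < ‖(z : ℂ)‖ ∧ ζ ∈ whitneyBall k z} ≤ lcmNorm p s μ ∧
      ((k : ℝ) + 1) ^ p ≤ 2 ^ s * (2 / Real.log 2) ^ p * ((1 / 2 : ℝ) ^ k) ^ s * c := by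
    cases k with
    | zero =>
      refine ⟨Real.log 2 ^ p, by positivity, le_trans ?_ (rpow_mul_measure_univ_le p s μ), ?_⟩
      · gcongr
        exact Set.subset_univ _
      · rw [mul_right_comm, mul_assoc (2 ^ s), ← Real.mul_rpow (by positivity) hl.le,
          div_mul_cancel₀ _ hl.ne']
        simp only [CharP.cast_eq_zero, zero_add, pow_zero, Real.one_rpow, mul_one]
        exact one_le_mul_of_one_le_of_one_le (Real.one_le_rpow (by norm_num) hs)
          (Real.one_le_rpow (by norm_num) hp.le)
    | succ k =>
      obtain ⟨θ, hθ⟩ := exists_setOf_mem_whitneyBall_subset_carlesonBox k ζ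
      have hlog : Real.log (2 / (1 / 2) ^ k) = (k + 1) * Real.log 2 := by
        rw [one_div, inv_pow, div_inv_eq_mul, ← pow_succ', Real.log_pow, Nat.cast_add_one]
      refine ⟨1 / ((1 / 2) ^ k) ^ s * Real.log (2 / (1 / 2) ^ k) ^ p, ?_, le_trans ?_
        (lcmQuotient_le_lcmNorm p s μ θ (by positivity : (0 : ℝ) < (1 / 2) ^ k)
          (pow_le_one₀ (by norm_num) (by norm_num))), ?_⟩
      · rw [hlog]; positivity
      · unfold lcmQuotient
        gcongr
      · have h1 : ((1 / 2 : ℝ) ^ (k + 1)) ^ s = ((1 / 2) ^ k) ^ s / 2 ^ s := by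
          rw [← Real.div_rpow (by positivity) (by norm_num)]; congr 1; ring
        have h2 : (2 / Real.log 2) ^ p * ((k + 1) * Real.log 2) ^ p = (2 * (k + 1)) ^ p := by
          rw [← Real.mul_rpow (by positivity) (by positivity)]; congr 1; field_simp
        have h3 : (0 : ℝ) < ((1 / 2) ^ k) ^ s := by positivity
        have h4 : (0 : ℝ) < 2 ^ s := by positivity
        rw [hlog, h1]
        calc (((k + 1 : ℕ) : ℝ) + 1) ^ p ≤ (2 * (k + 1)) ^ p := by
              gcongr; push_cast; linarith [(Nat.cast_nonneg k : (0 : ℝ) ≤ k)]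
          _ = _ := by rw [← h2]; field_simp
  have hk : ((k : ℝ≥0∞) + 1) ^ p = ENNReal.ofReal (((k : ℝ) + 1) ^ p) := by
    rw [← ENNReal.ofReal_rpow_of_nonneg (by positivity) hp.le,
      ENNReal.ofReal_add (by positivity) one_pos.le]
    simp
  rw [hk]
  calc _ ≤ ENNReal.ofReal (2 ^ s * (2 / Real.log 2) ^ p * ((1 / 2 : ℝ) ^ k) ^ s * c) *
        μ {z : disk | 1 - (1 / 2 : ℝ) ^ k < ‖(z : ℂ)‖ ∧ ζ ∈ whitneyBall k z} := by gcongr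
    _ = ENNReal.ofReal (2 ^ s * (2 / Real.log 2) ^ p) * ENNReal.ofReal (((1 / 2 : ℝ) ^ k) ^ s) *
        (ENNReal.ofReal c *
        μ {z : disk | 1 - (1 / 2 : ℝ) ^ k < ‖(z : ℂ)‖ ∧ ζ ∈ whitneyBall k z}) := by
      rw [ENNReal.ofReal_mul (by positivity), ENNReal.ofReal_mul (by positivity)]
      ring
    _ ≤ _ := by gcongr

/-! ### Bounded overlap of the Whitney annuli -/

/-- The annulus that contains the Whitney disks of generation `k`. -/
def whitneyAnnulus (k : ℕ) : Set ℂ :=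
  {ζ | (1 / 2 : ℝ) ^ k / 4 ≤ 1 - ‖ζ‖ ^ 2 ∧ 1 - ‖ζ‖ ^ 2 ≤ 4 * (1 / 2) ^ k}

theorem measurableSet_whitneyAnnulus (k : ℕ) : MeasurableSet (whitneyAnnulus k) :=
  MeasurableSet.inter (s₁ := {ζ : ℂ | (1 / 2 : ℝ) ^ k / 4 ≤ 1 - ‖ζ‖ ^ 2})
    (s₂ := {ζ : ℂ | 1 - ‖ζ‖ ^ 2 ≤ 4 * (1 / 2 : ℝ) ^ k})
    (measurableSet_le (by fun_prop) (by fun_prop)) (measurableSet_le (by fun_prop) (by fun_prop))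

theorem whitneyBall_subset_disk (k : ℕ) (z : ℂ) : whitneyBall k z ⊆ disk := by
  have hk0 : (0 : ℝ) < (1 / 2) ^ k := by positivity
  have hk1 : (1 / 2 : ℝ) ^ k ≤ 1 := pow_le_one₀ (by norm_num) (by norm_num)
  refine Metric.ball_subset_ball' ?_
  rw [dist_zero_right, norm_mul, Complex.norm_real, Real.norm_of_nonneg (by linarith)]
  nlinarith [norm_div_norm_le_one z]

theorem mem_whitneyAnnulus_of_mem_whitneyBall {k : ℕ} {z ζ : ℂ} (hz : 1 - (1 / 2 : ℝ) ^ k < ‖z‖)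
    (hζ : ζ ∈ whitneyBall k z) : ζ ∈ whitneyAnnulus k := by
  have hk0 : (0 : ℝ) < (1 / 2) ^ k := by positivity
  have hk1 : (1 / 2 : ℝ) ^ k ≤ 1 := pow_le_one₀ (by norm_num) (by norm_num)
  have hz0 : ‖z‖ ≠ 0 := by linarith
  have hd : ‖ζ - ((1 - (1 / 2) ^ k : ℝ) : ℂ) * (z / (‖z‖ : ℂ))‖ < 3 / 4 * (1 / 2) ^ k := by
    rw [← dist_eq_norm]; exact hζ
  have hn := (abs_norm_sub_norm_le ζ (((1 - (1 / 2) ^ k : ℝ) : ℂ) * (z / (‖z‖ : ℂ)))).trans hd.le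
  rw [norm_mul, Complex.norm_real, Real.norm_of_nonneg (by linarith), norm_div, Complex.norm_real,
    norm_norm, div_self hz0, mul_one, abs_le] at hn
  have h0 := norm_nonneg ζ
  constructor <;> nlinarith

theorem tsum_indicator_whitneyAnnulus_le (α : ℝ) {ζ : ℂ} (hζ : ζ ∈ disk) :
    ∑' k : ℕ, (whitneyAnnulus k).indicator
        (fun _ => ENNReal.ofReal (((1 / 2 : ℝ) ^ k) ^ α)) ζ ≤
      5 * ENNReal.ofReal (4 ^ |α|) * ENNReal.ofReal ((1 - ‖ζ‖ ^ 2) ^ α) := by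
  classical
  have hu : 0 < 1 - ‖ζ‖ ^ 2 := by
    have : ‖ζ‖ < 1 := by simpa using hζ
    nlinarith [norm_nonneg ζ]
  have hterm : ∀ k, (whitneyAnnulus k).indicator
        (fun _ => ENNReal.ofReal (((1 / 2 : ℝ) ^ k) ^ α)) ζ ≤
      ENNReal.ofReal (4 ^ |α|) * ENNReal.ofReal ((1 - ‖ζ‖ ^ 2) ^ α) := by
    intro k
    by_cases hk : ζ ∈ whitneyAnnulus k
    · rw [Set.indicator_of_mem hk, ← ENNReal.ofReal_mul (by positivity)]
      refine ENNReal.ofReal_le_ofReal ?_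
      have hh : (0 : ℝ) < (1 / 2) ^ k := by positivity
      -- The sign of α decides which of the two bounds defining the annulus is needed.
      rcases le_total 0 α with hα | hα
      · rw [abs_of_nonneg hα, ← Real.mul_rpow (by norm_num) hu.le]
        refine Real.rpow_le_rpow hh.le ?_ hα
        linarith [hk.1]
      · rw [abs_of_nonpos hα, Real.rpow_neg (by norm_num), ← Real.inv_rpow (by norm_num),
          ← Real.mul_rpow (by norm_num) hu.le]
        refine Real.rpow_le_rpow_of_nonpos (by positivity) ?_ hα
        linarith [hk.2]
    · rw [Set.indicator_of_notMem hk]; exact zero_le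
  by_cases hex : ∃ k, ζ ∈ whitneyAnnulus k
  · set m := Nat.find hex
    have hm : ζ ∈ whitneyAnnulus m := Nat.find_spec hex
    -- If ζ lies in the annuli m and k, then 2^{-m}/4 ≤ 4·2^{-k}, that is k ≤ m + 4. Starting from
    -- the least index m, at most five terms survive.
    rw [tsum_eq_sum (s := Finset.Ico m (m + 5))]
    · refine (Finset.sum_le_card_nsmul _ _ _ fun k _ => hterm k).trans ?_
      rw [Nat.card_Ico, add_tsub_cancel_left, nsmul_eq_mul, mul_assoc]
      norm_cast
    · intro k hk
      refine Set.indicator_of_notMem (fun hmem => hk ?_) _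
      have h1 : m ≤ k := Nat.find_min' hex hmem
      refine Finset.mem_Ico.2 ⟨h1, ?_⟩
      by_contra! h2
      have h3 : (1 / 2 : ℝ) ^ k ≤ (1 / 2) ^ (m + 5) :=
        pow_le_pow_of_le_one (by norm_num) (by norm_num) h2
      have h4 : (1 / 2 : ℝ) ^ (m + 5) = (1 / 2) ^ m / 32 := by ring
      have h5 : (0 : ℝ) < (1 / 2) ^ m := by positivity
      linarith [hmem.2, hm.1]
  · have : ∀ k, (whitneyAnnulus k).indicator
        (fun _ => ENNReal.ofReal (((1 / 2 : ℝ) ^ k) ^ α)) ζ = 0 := fun k =>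
      Set.indicator_of_notMem (fun h => hex ⟨k, h⟩) _
    simp only [this, tsum_zero]
    exact zero_le

/-! ### Exchange of integrals and the norm estimate -/

theorem lintegral_weightedArea {α : ℝ} (hα : -1 < α) {F : ℂ → ℝ≥0∞} (hF : Measurable F) :
    ∫⁻ ζ, F ζ ∂weightedArea α = ENNReal.ofReal ((α + 1) / Real.pi) *
      ∫⁻ ζ in disk, ENNReal.ofReal ((1 - ‖ζ‖ ^ 2) ^ α) * F ζ := by
  have hm : Measurable fun ζ : ℂ => ENNReal.ofReal ((1 - ‖ζ‖ ^ 2) ^ α) := by fun_prop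
  rw [weightedArea, lintegral_withDensity_eq_lintegral_mul _ (by fun_prop) hF,
    lintegral_smul_measure, smul_eq_mul, ← ENNReal.ofReal_inv_of_pos Real.pi_pos, div_eq_inv_mul,
    ENNReal.ofReal_mul (by positivity), mul_assoc,
    ← lintegral_const_mul (f := fun ζ => ENNReal.ofReal ((1 - ‖ζ‖ ^ 2) ^ α) * F ζ) _ (hm.mul hF)]
  congr 1
  refine lintegral_congr fun ζ => ?_
  rw [Pi.mul_apply, ENNReal.ofReal_mul (by linarith), mul_assoc]

/-- The pairs `(z, ζ)` with `ζ` in the `k`-th Whitney disk towards `z`, for `z` beyond its centre. -/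
def whitneyRelation (k : ℕ) : Set (disk × ℂ) :=
  {q | 1 - (1 / 2 : ℝ) ^ k < ‖(q.1 : ℂ)‖ ∧ q.2 ∈ whitneyBall k q.1}

theorem measurableSet_whitneyRelation (k : ℕ) : MeasurableSet (whitneyRelation k) :=
  MeasurableSet.inter (s₁ := {q : disk × ℂ | 1 - (1 / 2 : ℝ) ^ k < ‖(q.1 : ℂ)‖})
    (s₂ := {q : disk × ℂ | dist q.2 (((1 - (1 / 2) ^ k : ℝ) : ℂ) *
      ((q.1 : ℂ) / (‖(q.1 : ℂ)‖ : ℂ))) < 3 / 4 * (1 / 2 : ℝ) ^ k})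
    (measurableSet_lt (by fun_prop) (by fun_prop)) (measurableSet_lt (by fun_prop) (by fun_prop))

/-- Moving the dependence on z from the domain into a jointly measurable integrand gives
measurability in z and makes Tonelli's theorem applicable. -/
theorem indicator_lintegral_whitneyBall_eq (k : ℕ) (F : ℂ → ℝ≥0∞) (z : disk) :
    {w : ℂ | 1 - (1 / 2 : ℝ) ^ k < ‖w‖}.indicator (fun w => ∫⁻ ζ in whitneyBall k w, F ζ) z =
      ∫⁻ ζ in disk, (whitneyRelation k).indicator (fun q => F q.2) (z, ζ) := by
  by_cases hz : 1 - (1 / 2 : ℝ) ^ k < ‖(z : ℂ)‖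
  · rw [Set.indicator_of_mem (by exact hz)]
    have : ∀ ζ, (whitneyRelation k).indicator (fun q => F q.2) (z, ζ) =
        (whitneyBall k z).indicator F ζ := by
      intro ζ
      by_cases hζ : ζ ∈ whitneyBall k z
      · rw [Set.indicator_of_mem hζ, Set.indicator_of_mem (by exact ⟨hz, hζ⟩)]
      · rw [Set.indicator_of_notMem hζ, Set.indicator_of_notMem (fun h => hζ h.2)]
    have hm : MeasurableSet (whitneyBall k z) := Metric.isOpen_ball.measurableSet
    simp_rw [this]
    rw [lintegral_indicator hm, Measure.restrict_restrict hm,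
      Set.inter_eq_left.2 (whitneyBall_subset_disk k z)]
  · rw [Set.indicator_of_notMem (by exact hz)]
    have : ∀ ζ, (whitneyRelation k).indicator (fun q => F q.2) (z, ζ) = 0 := fun ζ =>
      Set.indicator_of_notMem (fun h => hz h.1) _
    simp [this]

theorem measurable_indicator_whitneyRelation (k : ℕ) {F : ℂ → ℝ≥0∞} (hF : Measurable F) :
    Measurable ((whitneyRelation k).indicator fun q => F q.2) :=
  (hF.comp measurable_snd).indicator (measurableSet_whitneyRelation k)

theorem lintegral_lintegral_whitneyBall_eq (μ : Measure disk) [SFinite μ] (k : ℕ) {F : ℂ → ℝ≥0∞}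
    (hF : Measurable F) :
    ∫⁻ z : disk, {w : ℂ | 1 - (1 / 2 : ℝ) ^ k < ‖w‖}.indicator
        (fun w => ∫⁻ ζ in whitneyBall k w, F ζ) z ∂μ =
      ∫⁻ ζ in disk, F ζ *
        μ {z : disk | 1 - (1 / 2 : ℝ) ^ k < ‖(z : ℂ)‖ ∧ ζ ∈ whitneyBall k z} := by
  simp_rw [indicator_lintegral_whitneyBall_eq]
  rw [lintegral_lintegral_swap (f := fun z ζ => (whitneyRelation k).indicator (fun q => F q.2) (z, ζ))
    (measurable_indicator_whitneyRelation k hF).aemeasurable]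
  refine lintegral_congr fun ζ => ?_
  have hm : MeasurableSet ((fun z : disk => (z, ζ)) ⁻¹' whitneyRelation k) :=
    measurable_prodMk_right (measurableSet_whitneyRelation k)
  exact (lintegral_congr fun z => rfl).trans (lintegral_indicator_const (μ := μ) hm (F ζ))

/-- The weight (k+1)^p is absorbed by the mass bound, and 2^{-k(p-2)} · 2^{-ks} is the weight
2^{-kα} with α = s+p-2. Summing over the annuli then produces (1-|ζ|²)^α. -/
theorem exists_lintegral_enorm_rpow_sub_le {p s : ℝ} (hp : 0 < p) (hs : 0 ≤ s) (hps : 1 < s + p) :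
    ∃ C : ℝ≥0, ∀ (μ : Measure disk) [SFinite μ] (f : ℂ → ℂ), DifferentiableOn ℂ f disk →
      ∫⁻ z : disk, ‖f z - f 0‖ₑ ^ p ∂μ ≤
        C * lcmNorm p s μ * ∫⁻ ζ, ‖deriv f ζ‖ₑ ^ p ∂weightedArea (s + p - 2) := by
  obtain ⟨C, hC⟩ := exists_enorm_rpow_sub_le_tsum hp
  set K : ℝ := 2 ^ s * (2 / Real.log 2) ^ p
  set α := s + p - 2 with hα
  refine ⟨C * K.toNNReal * (5 * (4 ^ |α| : ℝ).toNNReal) * (Real.pi / (α + 1)).toNNReal,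
    fun μ _ f hf => ?_⟩
  set N := lcmNorm p s μ
  set F : ℂ → ℝ≥0∞ := fun ζ => ‖deriv f ζ‖ₑ ^ p
  have hF : Measurable F := (measurable_deriv f).enorm.pow_const p
  set μT : ℕ → ℂ → ℝ≥0∞ := fun k ζ =>
    μ {z : disk | 1 - (1 / 2 : ℝ) ^ k < ‖(z : ℂ)‖ ∧ ζ ∈ whitneyBall k z} with hμT
  have hμTm : ∀ k, Measurable (μT k) := fun k =>
    measurable_measure_prodMk_right (measurableSet_whitneyRelation k)
  have hpt : ∀ (k : ℕ) (ζ : ℂ), ((k : ℝ≥0∞) + 1) ^ p * (ENNReal.ofReal (((1 / 2 : ℝ) ^ k) ^ (p - 2)) *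
      (F ζ * μT k ζ)) ≤ ENNReal.ofReal K * N * F ζ * (whitneyAnnulus k).indicator
        (fun _ => ENNReal.ofReal (((1 / 2 : ℝ) ^ k) ^ α)) ζ := by
    intro k ζ
    by_cases hk : ζ ∈ whitneyAnnulus k
    · rw [Set.indicator_of_mem hk]
      have hsplit : ENNReal.ofReal (((1 / 2 : ℝ) ^ k) ^ α) =
          ENNReal.ofReal (((1 / 2 : ℝ) ^ k) ^ s) * ENNReal.ofReal (((1 / 2 : ℝ) ^ k) ^ (p - 2)) := by
        rw [← ENNReal.ofReal_mul (by positivity), ← Real.rpow_add (by positivity), hα,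
          add_sub_assoc]
      calc _ = ENNReal.ofReal (((1 / 2 : ℝ) ^ k) ^ (p - 2)) * F ζ *
            (((k : ℝ≥0∞) + 1) ^ p * μT k ζ) := by ring
        _ ≤ ENNReal.ofReal (((1 / 2 : ℝ) ^ k) ^ (p - 2)) * F ζ *
            (ENNReal.ofReal K * ENNReal.ofReal (((1 / 2 : ℝ) ^ k) ^ s) * N) :=
          mul_le_mul_right (rpow_mul_measure_setOf_mem_whitneyBall_le hp hs μ k ζ) _
        _ = _ := by rw [hsplit]; ring
    · have : μT k ζ = 0 := by
        rw [hμT]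
        refine measure_mono_null (t := ∅) (fun z hz => ?_) measure_empty
        exact hk (mem_whitneyAnnulus_of_mem_whitneyBall hz.1 hz.2)
      simp [this]
  have hmeas : ∀ k, Measurable fun z : disk => {w : ℂ | 1 - (1 / 2 : ℝ) ^ k < ‖w‖}.indicator
      (fun w => ∫⁻ ζ in whitneyBall k w, F ζ) (z : ℂ) := by
    intro k
    simp_rw [indicator_lintegral_whitneyBall_eq]
    exact (measurable_indicator_whitneyRelation k hF).lintegral_prod_right'
  calc ∫⁻ z : disk, ‖f z - f 0‖ₑ ^ p ∂μ
      ≤ ∫⁻ z : disk, C * ∑' k : ℕ, ((k : ℝ≥0∞) + 1) ^ p *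
        (ENNReal.ofReal (((1 / 2 : ℝ) ^ k) ^ (p - 2)) *
          {w : ℂ | 1 - (1 / 2 : ℝ) ^ k < ‖w‖}.indicator
            (fun w => ∫⁻ ζ in whitneyBall k w, F ζ) z) ∂μ :=
        lintegral_mono fun z => hC f hf z z.2
    _ = C * ∑' k : ℕ, ((k : ℝ≥0∞) + 1) ^ p * (ENNReal.ofReal (((1 / 2 : ℝ) ^ k) ^ (p - 2)) *
          ∫⁻ ζ in disk, F ζ * μT k ζ) := by
        rw [lintegral_const_mul' _ _ ENNReal.coe_ne_top, lintegral_tsum fun k =>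
          (((hmeas k).const_mul _).const_mul _).aemeasurable]
        congr 1
        refine tsum_congr fun k => ?_
        rw [lintegral_const_mul _ ((hmeas k).const_mul _), lintegral_const_mul _ (hmeas k),
          lintegral_lintegral_whitneyBall_eq μ k hF]
    _ = C * ∑' k : ℕ, ∫⁻ ζ in disk, ((k : ℝ≥0∞) + 1) ^ p *
          (ENNReal.ofReal (((1 / 2 : ℝ) ^ k) ^ (p - 2)) * (F ζ * μT k ζ)) := by
        congr 1
        refine tsum_congr fun k => ?_
        have hm : Measurable fun ζ => F ζ * μT k ζ := hF.mul (hμTm k)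
        rw [lintegral_const_mul _ (hm.const_mul _), lintegral_const_mul _ hm]
    _ ≤ C * ∑' k : ℕ, ∫⁻ ζ in disk, ENNReal.ofReal K * N * F ζ * (whitneyAnnulus k).indicator
          (fun _ => ENNReal.ofReal (((1 / 2 : ℝ) ^ k) ^ α)) ζ := by
        refine mul_le_mul_right (ENNReal.tsum_le_tsum fun k => lintegral_mono fun ζ => hpt k ζ) _
    _ = C * ∫⁻ ζ in disk, ENNReal.ofReal K * N * F ζ * ∑' k : ℕ, (whitneyAnnulus k).indicator
          (fun _ => ENNReal.ofReal (((1 / 2 : ℝ) ^ k) ^ α)) ζ := by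
        have hm : ∀ k : ℕ, Measurable fun ζ => ENNReal.ofReal K * N * F ζ *
            (whitneyAnnulus k).indicator (fun _ => ENNReal.ofReal (((1 / 2 : ℝ) ^ k) ^ α)) ζ :=
          fun k => (hF.const_mul _).mul
            (measurable_const.indicator (measurableSet_whitneyAnnulus k))
        rw [← lintegral_tsum fun k => (hm k).aemeasurable]
        simp_rw [ENNReal.tsum_mul_left]
    _ ≤ C * ∫⁻ ζ in disk, ENNReal.ofReal K * N * F ζ *
          (5 * ENNReal.ofReal (4 ^ |α|) * ENNReal.ofReal ((1 - ‖ζ‖ ^ 2) ^ α)) := by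
        refine mul_le_mul_right (setLIntegral_mono' Metric.isOpen_ball.measurableSet
          fun ζ hζ => mul_le_mul_right (tsum_indicator_whitneyAnnulus_le α hζ) _) _
    _ = C * ENNReal.ofReal K * N * (5 * ENNReal.ofReal (4 ^ |α|)) *
          ∫⁻ ζ in disk, ENNReal.ofReal ((1 - ‖ζ‖ ^ 2) ^ α) * F ζ := by
        have hm : Measurable fun ζ : ℂ => ENNReal.ofReal ((1 - ‖ζ‖ ^ 2) ^ α) * F ζ :=
          Measurable.mul (by fun_prop) hF
        rw [mul_assoc, mul_assoc, mul_assoc, ← mul_assoc _ N, ← mul_assoc _ _ (∫⁻ _ in disk, _),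
          ← lintegral_const_mul _ hm]
        congr 1
        refine lintegral_congr fun ζ => ?_
        ring
    _ = _ := by
        -- This is where s + p > 1 enters: the normalizing factor (α+1)/π of the weighted area must
        -- be positive to be inverted.
        have hα1 : 0 < α + 1 := by rw [hα]; linarith
        rw [lintegral_weightedArea (by linarith) hF]
        have : ENNReal.ofReal (Real.pi / (α + 1)) * ENNReal.ofReal ((α + 1) / Real.pi) = 1 := by
          rw [← ENNReal.ofReal_mul (by positivity)]
          have : Real.pi / (α + 1) * ((α + 1) / Real.pi) = 1 := by field_simp
          rw [this, ENNReal.ofReal_one]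
        calc _ = (ENNReal.ofReal (Real.pi / (α + 1)) * ENNReal.ofReal ((α + 1) / Real.pi)) *
              (C * ENNReal.ofReal K * N * (5 * ENNReal.ofReal (4 ^ |α|)) *
              ∫⁻ ζ in disk, ENNReal.ofReal ((1 - ‖ζ‖ ^ 2) ^ α) * F ζ) := by rw [this, one_mul]
          _ = _ := by
            push_cast
            simp only [ENNReal.ofReal]
            ring

theorem exists_lintegral_enorm_rpow_le {p s : ℝ} (hp : 0 < p) (hs : 0 ≤ s) (hps : 1 < s + p) :
    ∃ C : ℝ≥0, ∀ (μ : Measure disk) [SFinite μ] (f : ℂ → ℂ), DifferentiableOn ℂ f disk →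
      ∫⁻ z : disk, ‖f z‖ₑ ^ p ∂μ ≤ C * lcmNorm p s μ * dirichletNorm p (s + p - 2) f ^ p := by
  obtain ⟨C, hC⟩ := exists_lintegral_enorm_rpow_sub_le hp hs hps
  have hl : 0 < Real.log 2 := Real.log_pos (by norm_num)
  set L : ℝ := (Real.log 2 ^ p)⁻¹
  refine ⟨2 ^ p * (C + L.toNNReal), fun μ _ f hf => ?_⟩
  set N := lcmNorm p s μ
  set B := dirichletNorm p (s + p - 2) f ^ p
  have hB1 : ‖f 0‖ₑ ^ p ≤ B := ENNReal.rpow_le_rpow le_self_add hp.le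
  have hB2 : ∫⁻ ζ, ‖deriv f ζ‖ₑ ^ p ∂weightedArea (s + p - 2) ≤ B := by
    calc _ = ((∫⁻ ζ, ‖deriv f ζ‖ₑ ^ p ∂weightedArea (s + p - 2)) ^ (1 / p)) ^ p := by
          rw [← ENNReal.rpow_mul, one_div_mul_cancel hp.ne', ENNReal.rpow_one]
      _ ≤ B := ENNReal.rpow_le_rpow le_add_self hp.le
  have hμ : μ Set.univ ≤ L.toNNReal * N := by
    have h := rpow_mul_measure_univ_le p s μ
    calc μ Set.univ = ENNReal.ofReal L * (ENNReal.ofReal (Real.log 2 ^ p) * μ Set.univ) := by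
          rw [← mul_assoc, ← ENNReal.ofReal_mul (by positivity),
            inv_mul_cancel₀ (by positivity), ENNReal.ofReal_one, one_mul]
      _ ≤ ENNReal.ofReal L * N := by gcongr
  -- Bounding the sum by twice the maximum gives a constant valid for p below and above 1 alike.
  have hpt : ∀ z : disk, ‖f z‖ₑ ^ p ≤ 2 ^ p * (‖f z - f 0‖ₑ ^ p + ‖f 0‖ₑ ^ p) := by
    intro z
    set a := ‖f z - f 0‖ₑ
    set b := ‖f 0‖ₑ
    have h1 : ‖f z‖ₑ ≤ 2 * max a b := by
      calc ‖f z‖ₑ = ‖(f z - f 0) + f 0‖ₑ := by rw [sub_add_cancel]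
        _ ≤ a + b := enorm_add_le _ _
        _ ≤ max a b + max a b := add_le_add (le_max_left _ _) (le_max_right _ _)
        _ = _ := (two_mul _).symm
    refine (ENNReal.rpow_le_rpow h1 hp.le).trans ?_
    rw [ENNReal.mul_rpow_of_nonneg _ _ hp.le]
    gcongr
    rcases le_total a b with h | h
    · rw [max_eq_right h]; exact le_add_self
    · rw [max_eq_left h]; exact le_self_add
  have h2 : (2 : ℝ≥0∞) ^ p ≠ ∞ := by finiteness
  calc ∫⁻ z : disk, ‖f z‖ₑ ^ p ∂μ
      ≤ ∫⁻ z : disk, 2 ^ p * (‖f z - f 0‖ₑ ^ p + ‖f 0‖ₑ ^ p) ∂μ := lintegral_mono hpt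
    _ = 2 ^ p * (∫⁻ z : disk, ‖f z - f 0‖ₑ ^ p ∂μ + ‖f 0‖ₑ ^ p * μ Set.univ) := by
        rw [lintegral_const_mul' _ _ h2, lintegral_add_right _ measurable_const, lintegral_const]
    _ ≤ 2 ^ p * (C * N * B + B * (L.toNNReal * N)) := by
        gcongr
        exact (hC μ f hf).trans (by gcongr)
    _ = _ := by
        rw [ENNReal.coe_mul, ENNReal.coe_rpow_of_nonneg _ hp.le]
        push_cast
        ring

/-! ### Finiteness and vanishing measures -/

theorem IsLogCarleson.lcmNorm_lt_top {p s : ℝ} {μ : Measure disk} (h : IsLogCarleson p s μ) :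
    lcmNorm p s μ < ∞ := by
  obtain ⟨C, -, hC⟩ := h
  exact hC.trans_lt ENNReal.coe_lt_top

theorem isFiniteMeasure_of_lcmNorm_lt_top {p s : ℝ} {μ : Measure disk} (h : lcmNorm p s μ < ∞) :
    IsFiniteMeasure μ := by
  have hl : 0 < Real.log 2 := Real.log_pos (by norm_num)
  refine ⟨ENNReal.lt_top_of_mul_ne_top_right
    ((rpow_mul_measure_univ_le p s μ).trans_lt h).ne ?_⟩
  rw [Ne, ENNReal.ofReal_eq_zero, not_le]
  positivity

theorem mem_arc_of_abs_arg_sub_le {z : ℂ} (hz : z ≠ 0) {θ ℓ : ℝ} (h : |z.arg - θ| ≤ Real.pi * ℓ) :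
    z / (‖z‖ : ℂ) ∈ arc θ ℓ := by
  refine ⟨z.arg, h, ?_⟩
  rw [div_eq_iff (by exact_mod_cast norm_ne_zero_iff.2 hz), mul_comm,
    Complex.norm_mul_exp_arg_mul_I]

theorem isCompact_setOf_norm_le {r : ℝ} (hr : r < 1) : IsCompact {z : disk | ‖(z : ℂ)‖ ≤ r} := by
  rw [Subtype.isCompact_iff]
  convert isCompact_closedBall (0 : ℂ) r using 1
  ext w
  simp only [Set.mem_image, mem_closedBall_zero_iff]
  constructor
  · rintro ⟨z, hz, rfl⟩
    exact hz
  · intro hw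
    exact ⟨⟨w, by rw [mem_ball_zero_iff]; linarith⟩, hw, rfl⟩

/-- For one small ℓ every box of length ℓ has finite mass. Finitely many of them cover 1-ℓ < |z| <
1, and the rest of the disk is compact. -/
theorem IsVanishingLogCarleson.isFiniteMeasure {p s : ℝ} {μ : Measure disk}
    [IsFiniteMeasureOnCompacts μ] (h : IsVanishingLogCarleson p s μ) : IsFiniteMeasure μ := by
  obtain ⟨δ, hδ, hb⟩ := h 1 one_pos
  set ℓ := min (δ / 2) (1 / 2) with hℓ
  have hℓ0 : 0 < ℓ := by positivity
  have hℓ1 : ℓ ≤ 1 / 2 := min_le_right _ _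
  have hℓδ : ℓ < δ := (min_le_left _ _).trans_lt (by linarith)
  have hbox : ∀ θ, μ (carlesonBox θ ℓ) < ∞ := by
    intro θ
    have h1 := hb θ ℓ hℓ0 (by linarith) hℓδ
    refine ENNReal.lt_top_of_mul_ne_top_right (h1.trans ENNReal.coe_lt_top).ne ?_
    rw [Ne, ENNReal.ofReal_eq_zero, not_le]
    have : 0 < Real.log (2 / ℓ) := Real.log_pos (by rw [lt_div_iff₀ hℓ0]; linarith)
    positivity
  have hcomp : μ {z : disk | ‖(z : ℂ)‖ ≤ 1 - ℓ} < ∞ :=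
    (isCompact_setOf_norm_le (by linarith)).measure_lt_top
  obtain ⟨m, hm⟩ := exists_nat_gt (2 / ℓ)
  refine ⟨lt_of_le_of_lt (measure_mono (t := {z : disk | ‖(z : ℂ)‖ ≤ 1 - ℓ} ∪
    ⋃ j ∈ Finset.range m, carlesonBox (-Real.pi + Real.pi * ℓ * j) ℓ) fun z _ => ?_) ?_⟩
  · rcases le_or_gt ‖(z : ℂ)‖ (1 - ℓ) with hz | hz
    · exact Or.inl hz
    right
    have hz0 : (z : ℂ) ≠ 0 := norm_ne_zero_iff.1 (by linarith)
    have hpl : 0 < Real.pi * ℓ := by positivity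
    -- The box centres are spaced by πℓ starting at -π, so the centre with index ⌊x⌋ is within πℓ of
    -- arg z, and ⌊x⌋ ≤ 2/ℓ < m.
    set x := ((z : ℂ).arg + Real.pi) / (Real.pi * ℓ) with hx
    have hx0 : 0 ≤ x := div_nonneg (by linarith [Complex.neg_pi_lt_arg (z : ℂ)]) hpl.le
    have hx2 : x ≤ 2 / ℓ := by
      rw [hx, div_le_div_iff₀ hpl hℓ0]
      nlinarith [Complex.arg_le_pi (z : ℂ)]
    have hxm : x * (Real.pi * ℓ) = (z : ℂ).arg + Real.pi := div_mul_cancel₀ _ hpl.ne'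
    have hf1 := Nat.floor_le hx0
    have hf2 := Nat.lt_floor_add_one x
    simp only [Set.mem_iUnion, Finset.mem_range]
    refine ⟨⌊x⌋₊, (Nat.floor_lt hx0).2 (hx2.trans_lt hm), Or.inl ⟨hz, ?_⟩⟩
    refine mem_arc_of_abs_arg_sub_le hz0 ?_
    rw [abs_le]
    constructor <;> nlinarith
  · refine (measure_union_le _ _).trans_lt (ENNReal.add_lt_top.2 ⟨hcomp, ?_⟩)
    exact (measure_biUnion_finset_le _ _).trans_lt (ENNReal.sum_lt_top.2 fun j _ => hbox _)

theorem exists_measure_setOf_lt_norm_le (μ : Measure disk) [IsFiniteMeasure μ] {ε : ℝ≥0∞}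
    (hε : 0 < ε) : ∃ r : ℝ, r < 1 ∧ μ {z : disk | r < ‖(z : ℂ)‖} ≤ ε := by
  set E : ℕ → Set disk := fun n => {z : disk | 1 - 1 / ((n : ℝ) + 1) < ‖(z : ℂ)‖} with hE
  have hmeas : ∀ n, NullMeasurableSet (E n) μ := fun n =>
    (measurableSet_lt (by fun_prop) (by fun_prop)).nullMeasurableSet
  have hanti : Antitone E := by
    intro m n hmn z hz
    have hz' : 1 - 1 / ((n : ℝ) + 1) < ‖(z : ℂ)‖ := hz
    have : 1 / ((n : ℝ) + 1) ≤ 1 / ((m : ℝ) + 1) := by gcongr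
    exact lt_of_le_of_lt (by linarith) hz'
  have hinter : ⋂ n, E n = ∅ := by
    refine Set.eq_empty_iff_forall_notMem.2 fun z hz => ?_
    have hz1 : ‖(z : ℂ)‖ < 1 := mem_ball_zero_iff.1 z.2
    obtain ⟨n, hn⟩ := exists_nat_one_div_lt (sub_pos.2 hz1)
    have : 1 - 1 / ((n : ℝ) + 1) < ‖(z : ℂ)‖ := Set.mem_iInter.1 hz n
    linarith
  have h := tendsto_measure_iInter_atTop hmeas hanti ⟨0, measure_ne_top _ _⟩
  rw [hinter, measure_empty] at h
  obtain ⟨n, hn⟩ := ((ENNReal.tendsto_nhds_zero.1 h) ε hε).exists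
  exact ⟨1 - 1 / ((n : ℝ) + 1), sub_lt_self _ (by positivity), hn⟩

/-- Arcs shorter than δ are handled by the vanishing condition. For longer arcs the factor in front
of the mass is bounded by its value at δ, and the mass of r < |z| < 1 is small for r near 1. -/
theorem IsVanishingLogCarleson.exists_lcmNorm_restrict_le {p s : ℝ} (hp : 0 < p) (hs : 0 ≤ s)
    {μ : Measure disk} [IsFiniteMeasure μ] (h : IsVanishingLogCarleson p s μ) {ε : ℝ≥0}
    (hε : 0 < ε) :
    ∃ r : ℝ, r < 1 ∧ lcmNorm p s (μ.restrict {z : disk | r < ‖(z : ℂ)‖}) ≤ ε := by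
  obtain ⟨δ, hδ, hb⟩ := h ε hε
  -- Nothing prevents δ from exceeding 1, but c is compared with other factors only when δ ≤ ℓ ≤ 1,
  -- where the logarithms are nonnegative.
  set c : ℝ := 1 / δ ^ s * Real.log (2 / δ) ^ p
  obtain ⟨η, hη, hηc⟩ := ENNReal.exists_nnreal_pos_mul_lt (a := ENNReal.ofReal c)
    ENNReal.ofReal_ne_top (ENNReal.coe_ne_zero.2 hε.ne')
  obtain ⟨r, hr, hμr⟩ := exists_measure_setOf_lt_norm_le μ (ENNReal.coe_pos.2 hη)
  refine ⟨r, hr, iSup_le fun θ => iSup_le fun ℓ => iSup_le fun hℓ => ?_⟩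
  rcases lt_or_ge ℓ δ with hlt | hge
  · refine le_trans ?_ (hb θ ℓ hℓ.1 hℓ.2 hlt).le
    unfold lcmQuotient
    gcongr
    exact Measure.restrict_le_self
  · refine le_trans ?_ hηc.le
    rw [mul_comm]
    unfold lcmQuotient
    have hlog : 0 ≤ Real.log (2 / ℓ) :=
      Real.log_nonneg (by rw [le_div_iff₀ hℓ.1]; linarith [hℓ.2])
    have hlog2 : Real.log (2 / ℓ) ≤ Real.log (2 / δ) :=
      Real.log_le_log (div_pos two_pos hℓ.1) (by gcongr)
    have hmass : μ.restrict {z : disk | r < ‖(z : ℂ)‖} (carlesonBox θ ℓ) ≤ η := by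
      refine le_trans (measure_mono (Set.subset_univ _)) ?_
      rwa [Measure.restrict_apply_univ]
    refine mul_le_mul' (ENNReal.ofReal_le_ofReal ?_) hmass
    change 1 / ℓ ^ s * Real.log (2 / ℓ) ^ p ≤ 1 / δ ^ s * Real.log (2 / δ) ^ p
    gcongr

theorem IsVanishingLogCarleson.isCompactCarlesonFor {p s : ℝ} (hp : 0 < p) (hs : 0 ≤ s)
    (hps : 1 < s + p) {μ : Measure disk} [IsFiniteMeasureOnCompacts μ]
    (h : IsVanishingLogCarleson p s μ) : IsCompactCarlesonFor p (s + p - 2) μ := by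
  have hfin : IsFiniteMeasure μ := h.isFiniteMeasure
  obtain ⟨C, hC⟩ := exists_lintegral_enorm_rpow_le hp hs hps
  rintro f hf ⟨M, hM⟩ hunif
  have key : Tendsto (fun n => ∫⁻ z : disk, ‖f n z‖ₑ ^ p ∂μ) atTop (𝓝 0) := by
    refine ENNReal.tendsto_nhds_zero.2 fun ε hε => ?_
    have hε2 : ε / 2 ≠ 0 := (ENNReal.half_pos hε.ne').ne'
    -- η bounds the LCM norm of μ near the boundary, and τ bounds |f_n|^p on the compact part. Each
    -- contribution is at most ε/2.
    obtain ⟨η, hη, hηε⟩ := ENNReal.exists_nnreal_pos_mul_lt (a := C * (M : ℝ≥0∞) ^ p)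
      (ENNReal.mul_ne_top ENNReal.coe_ne_top (by finiteness)) hε2
    obtain ⟨τ, hτ, hτε⟩ := ENNReal.exists_nnreal_pos_mul_lt (measure_ne_top μ Set.univ) hε2
    obtain ⟨r, hr, hμr⟩ := h.exists_lcmNorm_restrict_le hp hs hη
    have hK := hunif (Metric.closedBall 0 r) (isCompact_closedBall _ _)
      (Metric.closedBall_subset_ball hr)
    have hτp : (0 : ℝ) < (τ : ℝ) ^ (1 / p) := Real.rpow_pos_of_pos (by exact_mod_cast hτ) _
    filter_upwards [Metric.tendstoUniformlyOn_iff.1 hK _ hτp] with n hn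
    have hm : MeasurableSet {z : disk | r < ‖(z : ℂ)‖} :=
      measurableSet_lt (by fun_prop) (by fun_prop)
    rw [← lintegral_add_compl _ hm, ← ENNReal.add_halves ε]
    refine add_le_add ?_ ?_
    · calc _ ≤ C * lcmNorm p s (μ.restrict {z : disk | r < ‖(z : ℂ)‖}) *
            dirichletNorm p (s + p - 2) (f n) ^ p := hC _ _ (hf n).1
        _ ≤ C * η * (M : ℝ≥0∞) ^ p := by
          gcongr
          exact hM n
        _ = η * (C * (M : ℝ≥0∞) ^ p) := by ring
        _ ≤ _ := hηε.le
    · calc _ ≤ ∫⁻ _ in {z : disk | r < ‖(z : ℂ)‖}ᶜ, (τ : ℝ≥0∞) ∂μ := by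
            refine setLIntegral_mono' hm.compl fun z hz => ?_
            have hz' : ‖(z : ℂ)‖ ≤ r := not_lt.1 hz
            have h1 := hn z (by simpa using hz')
            rw [Pi.zero_apply, dist_zero_left] at h1
            rw [← ofReal_norm, ENNReal.ofReal_rpow_of_nonneg (norm_nonneg _) hp.le,
              ← ENNReal.ofReal_coe_nnreal]
            refine ENNReal.ofReal_le_ofReal ?_
            calc ‖f n z‖ ^ p ≤ ((τ : ℝ) ^ (1 / p)) ^ p :=
                  Real.rpow_le_rpow (norm_nonneg _) h1.le hp.le
              _ = (τ : ℝ) := by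
                rw [← Real.rpow_mul τ.coe_nonneg, one_div_mul_cancel hp.ne', Real.rpow_one]
        _ = τ * μ {z : disk | r < ‖(z : ℂ)‖}ᶜ := setLIntegral_const _ _
        _ ≤ τ * μ Set.univ := by gcongr; exact Set.subset_univ _
        _ ≤ _ := hτε.le
  have h1 : Tendsto (fun n => (∫⁻ z : disk, ‖f n z‖ₑ ^ p ∂μ) ^ (1 / p)) atTop
      (𝓝 ((0 : ℝ≥0∞) ^ (1 / p))) := key.ennrpow_const _
  rwa [ENNReal.zero_rpow_of_pos (by positivity)] at h1

end LogCarleson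

theorem lemma5 (p s : ℝ) (hp : 0 < p) (hs : 0 ≤ s) (hps : 1 < s + p) :
    (∃ C : ℝ≥0, ∀ μ : Measure LogCarleson.disk, LogCarleson.IsLogCarleson p s μ →
      LogCarleson.IsCarlesonFor p (s + p - 2) μ ∧
      LogCarleson.inclusionNorm p (s + p - 2) μ ^ p ≤ C * LogCarleson.lcmNorm p s μ) ∧
    (∀ μ : Measure LogCarleson.disk, IsFiniteMeasureOnCompacts μ →
      LogCarleson.IsVanishingLogCarleson p s μ →
      LogCarleson.IsCompactCarlesonFor p (s + p - 2) μ) := by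
  refine ⟨?_, fun μ _ h => h.isCompactCarlesonFor hp hs hps⟩
  obtain ⟨C, hC⟩ := LogCarleson.exists_lintegral_enorm_rpow_le hp hs hps
  refine ⟨C, fun μ hμ => ?_⟩
  have hN := hμ.lcmNorm_lt_top
  have hfin := LogCarleson.isFiniteMeasure_of_lcmNorm_lt_top hN
  -- The summand 1 only secures positivity of the constant, since the LCM norm may be 0.
  refine ⟨⟨C * (LogCarleson.lcmNorm p s μ).toNNReal + 1, by positivity, fun f hf => ?_⟩, ?_⟩
  · refine (hC μ f hf.1).trans ?_
    rw [ENNReal.coe_add, ENNReal.coe_mul, ENNReal.coe_toNNReal hN.ne]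
    gcongr
    exact le_self_add
  · rw [← ENNReal.le_rpow_inv_iff hp]
    refine iSup_le fun f => iSup_le fun hf => ?_
    unfold LogCarleson.lpNorm
    rw [one_div]
    refine ENNReal.rpow_le_rpow ?_ (by positivity)
    refine (hC μ f hf.1.1).trans (mul_le_of_le_one_right' ?_)
    exact ENNReal.rpow_le_one hf.2 hp.le
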